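/- Let $(X,d)$ be a complete metric space and let $(S(t))_{t\ge 0}$ be a dynamical system (nonlinear semigroup) on $X$: each $S(t):X\to X$ is continuous, $S(0)x=x$ for all $x\in X$, $S(t+s)=S(t)\circ S(s)$ for all $s,t\ge 0$, and for each $x\in X$ the map $t\mapsto S(t)x$ is continuous on $\mathbb R^+=[0,+\infty)$. A positive trajectory is a map $u:\mathbb R^+\to X$ of the form $u(t)=S(t)x$ for some $x\in X$; a complete trajectory is a map $u:\mathbb R\to X$ with $u(t+\tau)=S(\tau)u(t)$ for all $t\in\mathbb R$, $\tau\ge 0$. The family $(S(t))_{t\ge 0}$ is equicontinuous on a set $K\subset X$ if for every $\varepsilon>0$ there is $\delta>0$ such that, for all $x_1,x_2\in K$, $d(x_1,x_2)\le\delta$ implies $\sup_{t\ge 0}d(S(t)x_1,S(t)x_2)\le\varepsilon$. A map $u:\mathbb R\to X$ is periodic if there is $\omega>0$ with $u(t+\omega)=u(t)$ for all $t\in\mathbb R$; a map $u:\mathbb R^+\to X$ is periodic on $[t_0,+\infty)$ if there is $\omega>0$ with $u(t+\omega)=u(t)$ for all $t\ge t_0$. Then: (i) If $u$ is a positive trajectory,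 then $u$ is periodic on $[t_0,+\infty)$ for some $t_0\ge 0$ if and only if $u(\mathbb R^+)$ is compact and $(S(t))_{t\ge 0}$ is equicontinuous on $u(\mathbb R^+)$. (ii) If $u$ is a complete trajectory, then $u$ is periodic if and only if $u(\mathbb R)$ is compact and $(S(t))_{t\ge 0}$ is equicontinuous on $u(\mathbb R)$. (iii) There exists a periodic complete trajectory if and only if there exists a positive trajectory $u$ such that $u(\mathbb R^+)$ is compact and $(S(t))_{t\ge 0}$ is equicontinuous on $u(\mathbb R^+)$. -/

import Mathlib

open scoped NNReal

/-- A dynamical system (nonlinear semigroup) `(S(t))_{t ≥ 0}` on `X`. Only separate continuity in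
the space and in the time variable is required. -/
structure NonlinearSemigroup (X : Type*) [TopologicalSpace X] where
  /-- The maps `S(t) : X → X`, for `t ≥ 0`. -/
  toFun : ℝ≥0 → X → X
  continuous_space : ∀ t : ℝ≥0, Continuous (toFun t)
  map_zero : ∀ x : X, toFun 0 x = x
  map_add : ∀ (t s : ℝ≥0) (x : X), toFun (t + s) x = toFun t (toFun s x)
  continuous_time : ∀ x : X, Continuous fun t : ℝ≥0 => toFun t x

namespace NonlinearSemigroup

instance {X : Type*} [TopologicalSpace X] :
    CoeFun (NonlinearSemigroup X) fun _ => ℝ≥0 → X → X :=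
  ⟨NonlinearSemigroup.toFun⟩

/-- `u : ℝ⁺ → X` is a positive trajectory: `u = S(·)x` for some `x`. -/
def IsPositiveTrajectory {X : Type*} [TopologicalSpace X] (S : NonlinearSemigroup X)
    (u : ℝ≥0 → X) : Prop :=
  ∃ x : X, ∀ t : ℝ≥0, u t = S t x

/-- `u : ℝ → X` is a complete trajectory: `u (t + τ) = S(τ) (u t)` for all `t ∈ ℝ`, `τ ≥ 0`. -/
def IsCompleteTrajectory {X : Type*} [TopologicalSpace X] (S : NonlinearSemigroup X)
    (u : ℝ → X) : Prop :=
  ∀ (t : ℝ) (τ : ℝ≥0), u (t + (τ : ℝ)) = S τ (u t)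

/-- The family `(S(t))_{t ≥ 0}` is equicontinuous on `K`, with a modulus that is uniform in the
two points of `K` and in `t ≥ 0`; see `equicontinuousOn_iff` for the `ε`-`δ` form. -/
def EquicontinuousOn {X : Type*} [MetricSpace X] (S : NonlinearSemigroup X) (K : Set X) : Prop :=
  UniformEquicontinuousOn (fun t : ℝ≥0 => S t) K

theorem equicontinuousOn_iff {X : Type*} [MetricSpace X] (S : NonlinearSemigroup X) (K : Set X) :
    S.EquicontinuousOn K ↔
      ∀ ε : ℝ, 0 < ε → ∃ δ : ℝ, 0 < δ ∧ ∀ x₁ ∈ K, ∀ x₂ ∈ K, dist x₁ x₂ ≤ δ →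
        ∀ t : ℝ≥0, dist (S t x₁) (S t x₂) ≤ ε := by
  unfold EquicontinuousOn UniformEquicontinuousOn
  constructor
  · intro h ε hε
    have h1 := h _ (Metric.dist_mem_uniformity hε)
    rw [Filter.eventually_inf_principal] at h1
    obtain ⟨δ, hδ, h2⟩ := Metric.mem_uniformity_dist.1 h1
    refine ⟨δ / 2, half_pos hδ, fun x hx y hy hxy t => ?_⟩
    exact le_of_lt (h2 (lt_of_le_of_lt hxy (half_lt_self hδ)) ⟨hx, hy⟩ t)
  · intro h V hV
    obtain ⟨ε, hε, hV'⟩ := Metric.mem_uniformity_dist.1 hV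
    obtain ⟨δ, hδ, h2⟩ := h (ε / 2) (half_pos hε)
    rw [Filter.eventually_inf_principal]
    refine Metric.mem_uniformity_dist.2 ⟨δ, hδ, ?_⟩
    intro x y hxy hK t
    exact hV' (lt_of_le_of_lt (h2 x hK.1 y hK.2 hxy.le t) (half_lt_self hε))

end NonlinearSemigroup

/-- `u : ℝ⁺ → X` is periodic on `[t₀, +∞)`, with some period `ω > 0`. -/
def IsPeriodicFrom {X : Type*} (u : ℝ≥0 → X) (t₀ : ℝ≥0) : Prop :=
  ∃ ω : ℝ≥0, 0 < ω ∧ ∀ t : ℝ≥0, t₀ ≤ t → u (t + ω) = u t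

/-- `u : ℝ → X` is periodic, with some period `ω > 0`. -/
def IsPeriodicOnLine {X : Type*} (u : ℝ → X) : Prop :=
  ∃ ω : ℝ, 0 < ω ∧ Function.Periodic u ω

open Filter Topology Set

/-! Compactness of the range alone makes a positive trajectory eventually periodic. Its ω-limit set
is compact and forward invariant, and contains a tail of the trajectory. Countably many arcs of the
trajectory cover it, so by Baire one arc has interior in it; the trajectory re-enters that arc at
arbitrarily large times (`exists_frequently_mem`), and one coincidence `u r = u s` with `s < r`
gives a period. A complete trajectory is thus periodic from some time on, and equicontinuity carries
this to all earlier times. Conversely, a periodic orbit is the image of a compact time interval,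
whence compactness and equicontinuity. -/

/-- If `u` has period `ω` on `[t₀, +∞)`, two points of this half-line that are congruent modulo `ω`
have the same image. -/
theorem eq_of_add_nat_mul_eq {X : Type*} {u : ℝ≥0 → X} {t₀ ω : ℝ≥0}
    (h : ∀ t : ℝ≥0, t₀ ≤ t → u (t + ω) = u t) {a b : ℝ≥0} (ha : t₀ ≤ a) (hb : t₀ ≤ b) {m n : ℕ}
    (hab : a + m * ω = b + n * ω) : u a = u b := by
  have key : ∀ (n : ℕ) (t : ℝ≥0), t₀ ≤ t → u (t + n * ω) = u t := by
    intro n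
    induction n with
    | zero => intro t _; simp
    | succ k ih =>
      intro t ht
      rw [← ih t ht, ← h (t + k * ω) (ht.trans le_self_add)]
      congr 1
      push_cast
      ring
  rw [← key m a ha, hab, key n b hb]

theorem IsPeriodicFrom.exists_range_eq_image_Iic {X : Type*} {u : ℝ≥0 → X} {t₀ : ℝ≥0}
    (h : IsPeriodicFrom u t₀) : ∃ T : ℝ≥0, range u = u '' Iic T := by
  obtain ⟨ω, hω, h⟩ := h
  refine ⟨t₀ + ω, Subset.antisymm ?_ (image_subset_range _ _)⟩
  rintro _ ⟨t, rfl⟩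
  rcases le_or_gt t (t₀ + ω) with ht | ht
  · exact ⟨t, ht, rfl⟩
  have ht₀ : t₀ ≤ t := le_self_add.trans ht.le
  have h1 : (⌊(t - t₀) / ω⌋₊ : ℝ≥0) * ω ≤ t - t₀ := by
    rw [← le_div_iff₀ hω]
    exact Nat.floor_le (zero_le)
  have h2 : t - t₀ < ((⌊(t - t₀) / ω⌋₊ : ℝ≥0) + 1) * ω := by
    rw [← div_lt_iff₀ hω]
    exact Nat.lt_floor_add_one _
  set n := ⌊(t - t₀) / ω⌋₊
  rw [← NNReal.coe_le_coe] at h1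
  rw [← NNReal.coe_lt_coe] at h2
  push_cast [NNReal.coe_sub ht₀] at h1 h2
  have hsub : t - (t₀ + n * ω) + n * ω + t₀ = t := by
    have : t₀ + n * ω ≤ t := by
      rw [← NNReal.coe_le_coe]; push_cast; linarith
    rw [add_assoc, add_comm _ t₀, tsub_add_cancel_of_le this]
  -- The representative of `t` modulo `ω` in `[t₀, t₀ + ω)`.
  refine ⟨t₀ + (t - (t₀ + n * ω)), ?_, ?_⟩
  · rw [mem_Iic, ← NNReal.coe_le_coe]
    have := congrArg NNReal.toReal hsub
    push_cast at this ⊢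
    linarith
  · refine eq_of_add_nat_mul_eq h (m := n) (n := 0) le_self_add ht₀ ?_
    conv_rhs => rw [← hsub]
    push_cast
    ring

namespace NonlinearSemigroup

theorem IsPositiveTrajectory.continuous {X : Type*} [TopologicalSpace X]
    {S : NonlinearSemigroup X} {u : ℝ≥0 → X} (hu : S.IsPositiveTrajectory u) :
    Continuous u := by
  obtain ⟨x, hx⟩ := hu
  rw [funext hx]
  exact S.continuous_time x

theorem IsPositiveTrajectory.map_add {X : Type*} [TopologicalSpace X]
    {S : NonlinearSemigroup X} {u : ℝ≥0 → X} (hu : S.IsPositiveTrajectory u) (t s : ℝ≥0) :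
    u (t + s) = S s (u t) := by
  obtain ⟨x, hx⟩ := hu
  rw [hx, hx, add_comm, S.map_add]

/-- The state at one time determines the whole future, so a single coincidence suffices. -/
theorem IsPositiveTrajectory.isPeriodicFrom {X : Type*} [TopologicalSpace X]
    {S : NonlinearSemigroup X} {u : ℝ≥0 → X} (hu : S.IsPositiveTrajectory u) {s r : ℝ≥0}
    (hsr : s < r) (h : u r = u s) : IsPeriodicFrom u s := by
  refine ⟨r - s, tsub_pos_of_lt hsr, fun t ht => ?_⟩
  obtain ⟨a, rfl⟩ := exists_add_of_le ht
  rw [add_right_comm, add_tsub_cancel_of_le hsr.le, hu.map_add, h, ← hu.map_add]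

theorem IsCompleteTrajectory.isPositiveTrajectory {X : Type*} [TopologicalSpace X]
    {S : NonlinearSemigroup X} {u : ℝ → X} (hu : S.IsCompleteTrajectory u) (s : ℝ) :
    S.IsPositiveTrajectory fun t : ℝ≥0 => u (s + t) :=
  ⟨u s, fun t => hu s t⟩

theorem IsCompleteTrajectory.continuous {X : Type*} [TopologicalSpace X]
    {S : NonlinearSemigroup X} {u : ℝ → X} (hu : S.IsCompleteTrajectory u) :
    Continuous u := by
  refine continuous_iff_continuousAt.2 fun t => ?_
  -- Near `t`, `u` is the positive trajectory issued from `u (t - 1)`.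
  have h : ContinuousAt (fun r : ℝ => S (Real.toNNReal (r - (t - 1))) (u (t - 1))) t :=
    ((S.continuous_time _).comp
      (continuous_real_toNNReal.comp (continuous_id.sub continuous_const))).continuousAt
  refine h.congr ?_
  filter_upwards [lt_mem_nhds (sub_one_lt t)] with r hr
  rw [← hu, Real.coe_toNNReal _ (by linarith)]
  congr 1
  ring

/-- A positive trajectory which is periodic on a half-line has compact range. -/
theorem IsPositiveTrajectory.isCompact_range {X : Type*} [TopologicalSpace X]
    {S : NonlinearSemigroup X} {u : ℝ≥0 → X} (hu : S.IsPositiveTrajectory u) {t₀ : ℝ≥0}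
    (h : IsPeriodicFrom u t₀) : IsCompact (range u) := by
  obtain ⟨T, hT⟩ := h.exists_range_eq_image_Iic
  rw [hT, ← Icc_bot]
  exact isCompact_Icc.image hu.continuous

/-- The semigroup is equicontinuous along a positive trajectory which is periodic on a
half-line. -/
theorem IsPositiveTrajectory.equicontinuousOn_range {X : Type*} [MetricSpace X]
    {S : NonlinearSemigroup X} {u : ℝ≥0 → X} (hu : S.IsPositiveTrajectory u) {t₀ : ℝ≥0}
    (h : IsPeriodicFrom u t₀) : S.EquicontinuousOn (range u) := by
  obtain ⟨T, hT⟩ := h.exists_range_eq_image_Iic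
  have hc := hu.continuous
  rw [equicontinuousOn_iff]
  intro ε hε
  -- The triples violating `ε`. On them `u a ≠ u b`, since equal states have equal futures;
  -- compactness then bounds `dist (u a) (u b)` below.
  let C : Set (ℝ≥0 × ℝ≥0 × ℝ≥0) := Icc 0 T ×ˢ Icc 0 T ×ˢ Icc 0 T ∩
    {p | ε ≤ dist (u (p.1 + p.2.2)) (u (p.2.1 + p.2.2))}
  have hC : IsCompact C :=
    (isCompact_Icc.prod (isCompact_Icc.prod isCompact_Icc)).inter_right
      (isClosed_le continuous_const (by fun_prop))
  obtain ⟨δ, hδ, hδC⟩ : ∃ δ : ℝ, 0 < δ ∧ ∀ p ∈ C, δ < dist (u p.1) (u p.2.1) := by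
    rcases C.eq_empty_or_nonempty with hE | hne
    · exact ⟨1, one_pos, by simp [hE]⟩
    obtain ⟨q, hq, hmin⟩ := hC.exists_isMinOn hne
      (f := fun p => dist (u p.1) (u p.2.1)) (by fun_prop)
    have hpos : 0 < dist (u q.1) (u q.2.1) := by
      rw [dist_pos]
      intro heq
      have := hq.2
      rw [mem_ofPred_eq, hu.map_add, hu.map_add, heq, dist_self] at this
      exact absurd this hε.not_ge
    exact ⟨_, half_pos hpos, fun p hp => (half_lt_self hpos).trans_le (hmin hp)⟩
  refine ⟨δ, hδ, fun x₁ h₁ x₂ h₂ hd t => ?_⟩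
  obtain ⟨t', ht', hut⟩ : u t ∈ u '' Iic T := hT ▸ mem_range_self t
  rw [hT] at h₁ h₂
  obtain ⟨a, ha, rfl⟩ := h₁
  obtain ⟨b, hb, rfl⟩ := h₂
  -- `S t (u c) = S c (u t)` depends on `t` only through `u t`, so `t` can be replaced by `t' ≤ T`.
  have hshift : ∀ c, S t (u c) = u (c + t') := fun c => by
    rw [← hu.map_add, add_comm, hu.map_add, ← hut, ← hu.map_add, add_comm]
  rw [hshift, hshift]
  by_contra! hlt
  exact (hδC (a, b, t')
    ⟨⟨⟨zero_le, ha⟩, ⟨zero_le, hb⟩, ⟨zero_le, ht'⟩⟩, hlt.le⟩).not_ge hd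

/-- If a positive trajectory stays in a compact set that is covered by countably many closed sets,
and every point of the compact set flows into the trajectory, then the trajectory returns to one of
the closed sets at arbitrarily large times. -/
theorem IsPositiveTrajectory.exists_frequently_mem {X : Type*} [TopologicalSpace X] [T2Space X]
    {S : NonlinearSemigroup X} {u : ℝ≥0 → X} (hu : S.IsPositiveTrajectory u) {K : Set X}
    (hK : IsCompact K) (huK : range u ⊆ K) (hflow : ∀ y ∈ K, ∃ s t : ℝ≥0, S s y = u t)
    {F : ℕ → Set X} (hF : ∀ n, IsClosed (F n)) (hKF : K ⊆ ⋃ n, F n) :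
    ∃ n, ∃ᶠ r in atTop, u r ∈ F n := by
  -- The ω-limit set of `u`.
  let M : Set X := {y | MapClusterPt y atTop u}
  have hMclosed : IsClosed M := isClosed_setOfPred_clusterPt
  have hMK : M ⊆ K := fun y hy => by
    rw [← hK.isClosed.closure_eq, mem_closure_iff_frequently, frequently_iff]
    intro V hV
    obtain ⟨r, hr⟩ := (hy.frequently hV).exists
    exact ⟨u r, hr, huK (mem_range_self r)⟩
  have hMinv : ∀ s, ∀ y ∈ M, S s y ∈ M := by
    intro s y hy
    have h1 : MapClusterPt (S s y) atTop (S s ∘ u) :=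
      MapClusterPt.continuousAt_comp (S.continuous_space s).continuousAt hy
    have h2 : S s ∘ u = u ∘ fun t => t + s := funext fun t => (hu.map_add t s).symm
    rw [h2] at h1
    exact h1.of_comp (tendsto_atTop_mono (fun t => le_self_add) tendsto_id)
  obtain ⟨y, -, hy⟩ := hK.exists_mapClusterPt (f := atTop) (u := u)
    (tendsto_principal.2 (Eventually.of_forall fun t => huK (mem_range_self t)))
  obtain ⟨s, t₁, hst⟩ := hflow y (hMK hy)
  have htail : ∀ t, t₁ ≤ t → u t ∈ M := by
    intro t ht
    obtain ⟨a, rfl⟩ := exists_add_of_le ht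
    rw [hu.map_add, ← hst]
    exact hMinv _ _ (hMinv _ _ hy)
  have : CompactSpace M := isCompact_iff_compactSpace.1 (hK.of_isClosed_subset hMclosed hMK)
  have : Nonempty M := ⟨⟨y, hy⟩⟩
  -- Baire in the compact space `M`. As `z` is a cluster point of `u` and late values of `u` lie in
  -- `M`, visits near `z` fall in `F n`.
  obtain ⟨n, z, hz⟩ := nonempty_interior_of_iUnion_of_closed
    (f := fun n => ((↑) : M → X) ⁻¹' F n) (fun n => (hF n).preimage continuous_subtype_val)
    (by
      rw [← preimage_iUnion]
      exact eq_univ_of_forall fun m => hKF (hMK m.2))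
  rw [mem_interior_iff_mem_nhds, mem_nhds_subtype] at hz
  obtain ⟨V, hV, hVF⟩ := hz
  refine ⟨n, ((z.2.frequently hV).and_eventually (eventually_ge_atTop t₁)).mono ?_⟩
  rintro r ⟨hrV, hr⟩
  exact @hVF ⟨u r, htail r hr⟩ hrV

/-- A positive trajectory with compact range is periodic on some half-line. -/
theorem IsPositiveTrajectory.exists_isPeriodicFrom {X : Type*} [TopologicalSpace X] [T2Space X]
    {S : NonlinearSemigroup X} {u : ℝ≥0 → X} (hu : S.IsPositiveTrajectory u)
    (hK : IsCompact (range u)) : ∃ t₀ : ℝ≥0, IsPeriodicFrom u t₀ := by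
  obtain ⟨n, hn⟩ := hu.exists_frequently_mem hK Subset.rfl
    (by rintro _ ⟨t, rfl⟩; exact ⟨0, t, S.map_zero _⟩)
    (F := fun n : ℕ => u '' Icc 0 (n : ℝ≥0))
    (fun n => (isCompact_Icc.image hu.continuous).isClosed)
    (by
      rintro _ ⟨t, rfl⟩
      obtain ⟨n, hn⟩ := exists_nat_ge t
      exact mem_iUnion.2 ⟨n, t, ⟨zero_le, hn⟩, rfl⟩)
  obtain ⟨r, ⟨s, hs, hsr⟩, hr⟩ := (hn.and_eventually (eventually_gt_atTop (n : ℝ≥0))).exists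
  exact ⟨s, hu.isPeriodicFrom (hs.2.trans_lt hr) hsr.symm⟩

/-- A complete trajectory with compact range is periodic on some half-line. -/
theorem IsCompleteTrajectory.exists_isPeriodicFrom {X : Type*} [TopologicalSpace X] [T2Space X]
    {S : NonlinearSemigroup X} {u : ℝ → X} (hu : S.IsCompleteTrajectory u)
    (hK : IsCompact (range u)) : ∃ s : ℝ, IsPeriodicFrom (fun t : ℝ≥0 => u (s + t)) 0 := by
  obtain ⟨n, hn⟩ := (hu.isPositiveTrajectory 0).exists_frequently_mem hK
    (by rintro _ ⟨t, rfl⟩; exact mem_range_self _)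
    (by
      rintro _ ⟨t, rfl⟩
      refine ⟨Real.toNNReal (-t), Real.toNNReal t, ?_⟩
      rw [← hu]
      congr 1
      rcases le_total 0 t with h | h
      · simp [h]
      · simp [h, Real.toNNReal_of_nonpos h])
    (F := fun n : ℕ => u '' Icc (-n : ℝ) n)
    (fun n => (isCompact_Icc.image hu.continuous).isClosed)
    (by
      rintro _ ⟨t, rfl⟩
      obtain ⟨n, hn⟩ := exists_nat_ge |t|
      exact mem_iUnion.2 ⟨n, t, abs_le.1 hn, rfl⟩)
  obtain ⟨r, ⟨s, hs, hsr⟩, hr⟩ := (hn.and_eventually (eventually_gt_atTop (n : ℝ≥0))).exists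
  have hr' : (n : ℝ) < r := by exact_mod_cast hr
  have hlt : s < r := hs.2.trans_lt hr'
  refine ⟨s, (hu.isPositiveTrajectory s).isPeriodicFrom (r := Real.toNNReal (r - s))
    (Real.toNNReal_pos.2 (sub_pos.2 hlt)) ?_⟩
  simpa [Real.coe_toNNReal _ (sub_nonneg.2 hlt.le)] using hsr.symm

/-- A complete trajectory with compact range along which the semigroup is equicontinuous is
periodic. -/
theorem IsCompleteTrajectory.isPeriodicOnLine {X : Type*} [MetricSpace X]
    {S : NonlinearSemigroup X} {u : ℝ → X} (hu : S.IsCompleteTrajectory u)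
    (hK : IsCompact (range u)) (hE : S.EquicontinuousOn (range u)) : IsPeriodicOnLine u := by
  obtain ⟨s, hs⟩ := hu.exists_isPeriodicFrom hK
  have hP : IsClosed (range fun t : ℝ≥0 => u (s + t)) :=
    ((hu.isPositiveTrajectory s).isCompact_range hs).isClosed
  -- For large `k` with `u (-k)` near `u p`, equicontinuity puts `u t = S (t + k) (u (-k))` near `u
  -- (p + t + k)`, a point of the closed periodic orbit.
  obtain ⟨_, ⟨p, rfl⟩, hp⟩ := hK.exists_mapClusterPt (f := atTop) (u := fun k : ℝ≥0 => u (-k))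
    (tendsto_principal.2 (Eventually.of_forall fun t => mem_range_self _))
  have hmem : ∀ t, u t ∈ range fun t : ℝ≥0 => u (s + t) := by
    intro t
    rw [← hP.closure_eq, Metric.mem_closure_iff]
    intro ε hε
    obtain ⟨δ, hδ, hδE⟩ := (S.equicontinuousOn_iff _).1 hE (ε / 2) (half_pos hε)
    obtain ⟨k, hk, hkt⟩ := ((hp.frequently (Metric.closedBall_mem_nhds _ hδ)).and_eventually
      (eventually_ge_atTop (Real.toNNReal (-t) + Real.toNNReal (s - p - t)))).exists
    have hk1 : -t ≤ k ∧ s - p - t ≤ k := by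
      have h1 := Real.le_coe_toNNReal (-t)
      have h2 := Real.le_coe_toNNReal (s - p - t)
      have h3 := (Real.toNNReal (-t)).coe_nonneg
      have h4 := (Real.toNNReal (s - p - t)).coe_nonneg
      have h5 := NNReal.coe_le_coe.2 hkt
      push_cast at h5
      constructor <;> linarith
    have hd := hδE _ (mem_range_self (-(k : ℝ))) _ (mem_range_self p) hk
      (Real.toNNReal (t + k))
    rw [← hu, ← hu, Real.coe_toNNReal _ (by linarith [hk1.1]), show -(k : ℝ) + (t + k) = t by ring] at hd
    refine ⟨_, ⟨Real.toNNReal (p + (t + k) - s), rfl⟩, ?_⟩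
    simp only [Real.coe_toNNReal _ (show 0 ≤ p + (t + k) - s by linarith [hk1.2])]
    rw [add_sub_cancel]
    exact hd.trans_lt (half_lt_self hε)
  obtain ⟨ω, hω, h⟩ := hs
  refine ⟨ω, hω, fun t => ?_⟩
  obtain ⟨a, ha⟩ := hmem t
  have h1 := h a (zero_le)
  beta_reduce at ha h1
  rw [(hu.isPositiveTrajectory s).map_add] at h1
  rw [hu, ← ha, h1]

/-- A positive trajectory which is periodic on a half-line extends its periodic part to a periodic
complete trajectory. -/
theorem IsPositiveTrajectory.exists_isCompleteTrajectory {X : Type*} [TopologicalSpace X]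
    {S : NonlinearSemigroup X} {u : ℝ≥0 → X} (hu : S.IsPositiveTrajectory u) {t₀ : ℝ≥0}
    (h : IsPeriodicFrom u t₀) : ∃ v : ℝ → X, S.IsCompleteTrajectory v ∧ IsPeriodicOnLine v := by
  obtain ⟨ω, hω, h⟩ := h
  -- Enough periods to make `t + N t * ω` nonnegative; the value of `v` does not depend on how many
  -- are added.
  let N : ℝ → ℕ := fun t => ⌈|t| / ω⌉₊
  have hω' : (0 : ℝ) < ω := hω
  have hN : ∀ t, 0 ≤ t + N t * ω := fun t => by
    have h1 : |t| ≤ N t * ω := by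
      rw [← div_le_iff₀ hω']
      exact Nat.le_ceil _
    linarith [neg_abs_le t]
  let v : ℝ → X := fun t => u (t₀ + Real.toNNReal (t + N t * ω))
  have hv : S.IsCompleteTrajectory v := by
    intro t τ
    change u _ = S τ (u _)
    rw [← hu.map_add]
    refine eq_of_add_nat_mul_eq h (m := N t) (n := N (t + τ)) le_self_add
      (le_self_add.trans le_self_add) ?_
    apply NNReal.coe_injective
    push_cast
    simp only [Real.coe_toNNReal _ (hN _)]
    ring
  refine ⟨v, hv, ω, hω, fun t => ?_⟩
  rw [hv]
  change S ω (u _) = u _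
  rw [← hu.map_add, h _ le_self_add]

theorem _root_.IsPeriodicOnLine.isPeriodicFrom {X : Type*} {u : ℝ → X} (h : IsPeriodicOnLine u) :
    IsPeriodicFrom (fun t : ℝ≥0 => u (0 + t)) 0 := by
  obtain ⟨ω, hω, h⟩ := h
  refine ⟨Real.toNNReal ω, Real.toNNReal_pos.2 hω, fun t _ => ?_⟩
  beta_reduce
  rw [NNReal.coe_add, Real.coe_toNNReal _ hω.le, ← add_assoc, h]

theorem _root_.IsPeriodicOnLine.range_eq {X : Type*} {u : ℝ → X} (h : IsPeriodicOnLine u) :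
    range (fun t : ℝ≥0 => u (0 + t)) = range u := by
  obtain ⟨ω, hω, h⟩ := h
  refine Subset.antisymm (by rintro _ ⟨t, rfl⟩; exact mem_range_self _) ?_
  rintro _ ⟨t, rfl⟩
  obtain ⟨y, hy, hty⟩ := h.exists_mem_Ico₀ hω t
  exact ⟨Real.toNNReal y, by simp [hty, Real.coe_toNNReal _ hy.1]⟩

end NonlinearSemigroup

theorem corollary5p3 {X : Type*} [MetricSpace X] [CompleteSpace X] (S : NonlinearSemigroup X) :
    (∀ u : ℝ≥0 → X, S.IsPositiveTrajectory u →
      ((∃ t₀ : ℝ≥0, IsPeriodicFrom u t₀) ↔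
        IsCompact (Set.range u) ∧ S.EquicontinuousOn (Set.range u))) ∧
    (∀ u : ℝ → X, S.IsCompleteTrajectory u →
      (IsPeriodicOnLine u ↔
        IsCompact (Set.range u) ∧ S.EquicontinuousOn (Set.range u))) ∧
    ((∃ v : ℝ → X, S.IsCompleteTrajectory v ∧ IsPeriodicOnLine v) ↔
      ∃ u : ℝ≥0 → X, S.IsPositiveTrajectory u ∧
        IsCompact (Set.range u) ∧ S.EquicontinuousOn (Set.range u)) := by
  refine ⟨fun u hu => ⟨?_, fun h => hu.exists_isPeriodicFrom h.1⟩,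
    fun u hu => ⟨fun h => ?_, fun h => hu.isPeriodicOnLine h.1 h.2⟩, ?_, ?_⟩
  · rintro ⟨t₀, h⟩
    exact ⟨hu.isCompact_range h, hu.equicontinuousOn_range h⟩
  · rw [← h.range_eq]
    exact ⟨(hu.isPositiveTrajectory 0).isCompact_range h.isPeriodicFrom,
      (hu.isPositiveTrajectory 0).equicontinuousOn_range h.isPeriodicFrom⟩
  · rintro ⟨v, hv, h⟩
    have hu := hv.isPositiveTrajectory 0
    exact ⟨_, hu, hu.isCompact_range h.isPeriodicFrom, hu.equicontinuousOn_range h.isPeriodicFrom⟩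
  · rintro ⟨u, hu, hK, -⟩
    obtain ⟨t₀, h⟩ := hu.exists_isPeriodicFrom hK
    exact hu.exists_isCompleteTrajectory h
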